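/- Let $G$ be a finite group, and let $\mathrm{Irr}(G)$ denote the set of its complex irreducible characters. For subgroups $A,H\le G$ with $H$ normal, put $C=C_H(A)$ and $D=[H,A]$, and say that $(A,H)$ satisfies $(\ast)$ if $G=AH$, $A>1$ is cyclic, $H=CD$, $C$ is abelian, $D$ is normal in $G$, $C\cap D=1$, and the conjugation action of $A$ on $D$ is Frobenius (that is, $a d a^{-1}\ne d$ for all $1\ne a\in A$ and $1\ne d\in D$). **Theorem 3.2.** Let $p$ be a prime. Then $\chi(xy)=\chi(x)\chi(y)$ for every nonidentity $p$-element $x\in G$, every nonidentity $p'$-element $y\in G$ of prime power order and every $\chi\in\mathrm{Irr}(G)$ if and only if $G$ is a $p$-group, or $G$ is a $p'$-group, or $G$ is abelian, or there are a cyclic subgroup $A>1$ of $G$ and a subgroup $H$ which is either a normal Sylow $p$-subgroup or a normal Hall $p'$-subgroup of $G$ such that $(A,H)$ satisfies $(\ast)$. **Theorem C.** Moreover, $\chi(xy)=\chi(x)\chi(y)$ for all nonidentity elements $x,y\in G$ of prime power order with $(o(x),o(y))=1$ and every $\chi\in\mathrm{Irr}(G)$ if and only if $G$ has prime power order, or $G$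 is abelian, or for some prime $q$ there are a cyclic $q'$-subgroup $A>1$ and a normal Sylow $q$-subgroup $P$ of $G$ such that $(A,P)$ satisfies $(\ast)$. -/

import Mathlib

open scoped Pointwise

/-- `Irr(G)`: the set of complex irreducible characters of `G`, i.e. the trace functions of the
irreducible finite-dimensional complex representations (all of which are, up to isomorphism,
representations on some `ℂⁿ`). Irreducible representations are nonzero by definition. -/
def IrrChar (G : Type*) [Group G] : Set (G → ℂ) :=
  {χ | ∃ (n : ℕ) (ρ : Representation ℂ G (Fin n → ℂ)), ρ.IsIrreducible ∧ ρ.character = χ}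

/-- `x` is a `p`-element: its order is a power of `p` (the identity is allowed). -/
def IsPElement (p : ℕ) {G : Type*} [Group G] (x : G) : Prop :=
  ∃ k : ℕ, orderOf x = p ^ k

/-- `x` has prime power order: its order is `q ^ k` for a prime `q` and `k ≥ 0`
(the identity is allowed). -/
def HasPrimePowerOrder {G : Type*} [Group G] (x : G) : Prop :=
  ∃ q k : ℕ, q.Prime ∧ orderOf x = q ^ k

/-- `x` is a `p'`-element: its order is not divisible by the prime `p`. -/
def IsPPrimeElement (p : ℕ) {G : Type*} [Group G] (x : G) : Prop :=
  ¬ p ∣ orderOf x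

/-- `H` is a `p'`-group: its order is not divisible by the prime `p`. -/
def IsPPrimeGroup (p : ℕ) (H : Type*) [Group H] : Prop :=
  ¬ p ∣ Nat.card H

/-- `H` is a Sylow `p`-subgroup of the finite group `G`: its order is a power of `p`
and its index is prime to `p`. -/
def IsSylowSubgroup (p : ℕ) {G : Type*} [Group G] (H : Subgroup G) : Prop :=
  IsPGroup p H ∧ ¬ p ∣ H.index

/-- `H` is a Hall `p'`-subgroup of the finite group `G`: its order is prime to `p`
and its index is a power of `p`. -/
def IsHallPPrimeSubgroup (p : ℕ) {G : Type*} [Group G] (H : Subgroup G) : Prop :=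
  IsPPrimeGroup p H ∧ ∃ k : ℕ, H.index = p ^ k

/-- `A` normalizes `D` and its conjugation action on `D` is Frobenius: no nonidentity element of
`A` fixes a nonidentity element of `D`. -/
def IsFrobeniusAction {G : Type*} [Group G] (A D : Subgroup G) : Prop :=
  A ≤ Subgroup.normalizer (D : Set G) ∧ ∀ a ∈ A, a ≠ 1 → ∀ d ∈ D, d ≠ 1 → a * d * a⁻¹ ≠ d

/-- `C_H(A)`: the elements of `H` that commute with every element of `A`. -/
def centralizerIn {G : Type*} [Group G] (H A : Subgroup G) : Subgroup G :=
  H ⊓ Subgroup.centralizer (A : Set G)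

/-- The structure shared by both classifications: `G = AH` with `A > 1` cyclic and `H` normal;
for `C = C_H(A)` and `D = [H, A]` one has `H = CD`, `C` is abelian, `D` is normal in `G` and
`C ∩ D = 1`; and `A` acts Frobeniusly on `D`. -/
structure HasFrobeniusStructure {G : Type*} [Group G] (A H : Subgroup G) : Prop where
  eq_mul : (A : Set G) * (H : Set G) = Set.univ
  ne_bot : A ≠ ⊥
  isCyclic : IsCyclic A
  normal : H.Normal
  eq_CD : (centralizerIn H A : Set G) * ((⁅H, A⁆ : Subgroup G) : Set G) = (H : Set G)
  abelian_C : ∀ x ∈ centralizerIn H A, ∀ y ∈ centralizerIn H A, x * y = y * x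
  normal_D : (⁅H, A⁆ : Subgroup G).Normal
  inf_CD : centralizerIn H A ⊓ ⁅H, A⁆ = ⊥
  frobenius : IsFrobeniusAction A ⁅H, A⁆

/-! ### Schur's lemma, class sums, and vanishing of irreducible characters -/

section Representation

open scoped commutatorElement

variable {G : Type*} [Group G] {n : ℕ} {ρ : Representation ℂ G (Fin n → ℂ)}

/-! Averaging χ(x y^g) over g gives χ(x)χ(y)/χ(1). Multiplicativity at all conjugates of y therefore
forces χ(x)χ(y) = 0 for every nonlinear χ. Column orthogonality turns vanishing of all nonlinear
characters at z into "zG' lies in one conjugacy class". The crux is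
`forall_isConj_mul_or_forall_isConj_mul`: this coset property holds at all the p-elements x or at
all the p'-elements y in question. Otherwise one nonlinear character vanishes at every such y and
has degree divisible by |G|_{p'}, while another vanishes at every such x and has degree divisible by
|G|_p. As squared degrees are at most |G|, this gives |G|_p = |G|_{p'}, which is impossible when p
divides |G|. The coset property at elements of prime order q gives q ∤ |G'| and makes these elements
act without fixed points on G'. A normal Hall subgroup containing G' then has a complement A by
Schur–Zassenhaus; A is abelian, acts freely on G', and so is cyclic
(`hasFrobeniusStructure_of_isComplement`, where D = G'). Conversely, in such a structure zD lies in
one class for z ∉ H, and G/D is abelian, so nonlinear characters vanish off H. For x, y of coprime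
order, not both in H, both sides of the identity are then 0. -/

theorem Representation.IsIrreducible.exists_eq_smul_one (hρ : ρ.IsIrreducible)
    (T : (Fin n → ℂ) →ₗ[ℂ] (Fin n → ℂ)) (hT : ∀ g, T ∘ₗ ρ g = ρ g ∘ₗ T) :
    ∃ c : ℂ, T = c • LinearMap.id := by
  let f : Representation.IntertwiningMap ρ ρ := ⟨T, hT⟩
  obtain ⟨c, hc⟩ :=
    (Representation.IsIrreducible.algebraMap_intertwiningMap_bijective_of_isAlgClosed
      (ρ := ρ)).2 f
  refine ⟨c, ?_⟩
  have := congrArg Representation.IntertwiningMap.toLinearMap hc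
  rw [Algebra.algebraMap_eq_smul_one] at this
  exact this.symm

theorem Representation.IsIrreducible.submodule_eq_bot_or_eq_top (hρ : ρ.IsIrreducible)
    (W : Submodule ℂ (Fin n → ℂ)) (hW : ∀ g, ∀ v ∈ W, ρ g v ∈ W) : W = ⊥ ∨ W = ⊤ := by
  rcases IsSimpleOrder.eq_bot_or_eq_top (⟨W, fun g v hv => hW g v hv⟩ : Subrepresentation ρ) with h | h
  · left
    exact congrArg Subrepresentation.toSubmodule h
  · right
    exact congrArg Subrepresentation.toSubmodule h

theorem Representation.IsIrreducible.ne_zero (hρ : ρ.IsIrreducible) : n ≠ 0 := by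
  rintro rfl
  obtain ⟨a, b, hab⟩ := hρ.toNontrivial
  apply hab
  apply Subrepresentation.toSubmodule_injective
  exact Subsingleton.elim _ _

theorem Representation.isIrreducible_of_forall (hn : n ≠ 0)
    (h : ∀ W : Submodule ℂ (Fin n → ℂ), (∀ g, ∀ v ∈ W, ρ g v ∈ W) → W = ⊥ ∨ W = ⊤) :
    ρ.IsIrreducible := by
  have hnt : Nontrivial (Subrepresentation ρ) := by
    refine ⟨⊥, ⊤, fun hbt => ?_⟩
    have h2 : (⊥ : Submodule ℂ (Fin n → ℂ)) = ⊤ := congrArg Subrepresentation.toSubmodule hbt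
    have : Nonempty (Fin n) := Fin.pos_iff_nonempty.mp (Nat.pos_of_ne_zero hn)
    exact bot_ne_top h2
  refine ⟨fun W => ?_⟩
  rcases h W.toSubmodule (fun g v hv => W.apply_mem_toSubmodule g hv) with h | h
  · exact Or.inl (Subrepresentation.toSubmodule_injective h)
  · exact Or.inr (Subrepresentation.toSubmodule_injective h)

theorem Representation.character_one_eq : ρ.character 1 = n := by
  simp

theorem Representation.character_mul_of_degree_one (hn : n = 1) (x y : G) :
    ρ.character (x * y) = ρ.character x * ρ.character y := by
  subst hn
  have key : ∀ T : (Fin 1 → ℂ) →ₗ[ℂ] (Fin 1 → ℂ),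
      LinearMap.trace ℂ _ T = T (fun _ => 1) 0 := by
    intro T
    rw [LinearMap.trace_eq_matrix_trace ℂ (Pi.basisFun ℂ (Fin 1))]
    simp only [Matrix.trace, Finset.univ_unique, Fin.default_eq_zero, Finset.sum_singleton,
      Matrix.diag_apply, LinearMap.toMatrix_apply, Pi.basisFun_apply, Pi.basisFun_repr]
    have h1 : (Pi.single 0 1 : Fin 1 → ℂ) = fun _ => 1 := by
      ext i
      simp [Subsingleton.elim i 0]
    rw [h1]
  simp only [Representation.character, key, map_mul, Module.End.mul_apply]
  have : (ρ y) (fun _ => 1) = (ρ y (fun _ => 1) 0) • (fun _ => 1) := by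
    ext i
    simp [Subsingleton.elim i 0]
  rw [this, map_smul]
  simp [mul_comm]

/-- The operator ∑ ρ(g y g⁻¹) commutes with G, so it is a scalar c; its trace gives c n = |G| χ(y),
and multiplying it by ρ(x) before taking the trace gives the sum. -/
theorem Representation.IsIrreducible.sum_character_mul_conj [Fintype G] (hρ : ρ.IsIrreducible)
    (x y : G) : (∑ g : G, ρ.character (x * (g * y * g⁻¹))) * n =
      Fintype.card G * (ρ.character x * ρ.character y) := by
  obtain ⟨c, hc⟩ := hρ.exists_eq_smul_one (∑ g : G, ρ (g * y * g⁻¹)) (by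
    intro h
    change (∑ g : G, ρ (g * y * g⁻¹)) * ρ h = ρ h * (∑ g : G, ρ (g * y * g⁻¹))
    rw [Finset.sum_mul, Finset.mul_sum]
    refine Fintype.sum_equiv (Equiv.mulLeft h⁻¹) _ _ fun g => ?_
    rw [← map_mul, ← map_mul]
    congr 1
    simp [mul_assoc])
  have h1 : Fintype.card G * ρ.character y = c * n := by
    have := congrArg (LinearMap.trace ℂ (Fin n → ℂ)) hc
    rw [map_sum, map_smul, LinearMap.trace_id] at this
    have h2 : ∀ g : G, LinearMap.trace ℂ (Fin n → ℂ) (ρ (g * y * g⁻¹)) = ρ.character y :=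
      fun g => Representation.char_conj ρ y g
    simpa only [h2, Finset.sum_const, Finset.card_univ, nsmul_eq_mul, smul_eq_mul,
      Module.finrank_fin_fun] using this
  have h2 : ∑ g : G, ρ.character (x * (g * y * g⁻¹)) = c * ρ.character x := by
    have : ρ x * (∑ g : G, ρ (g * y * g⁻¹)) = c • ρ x := by
      rw [hc]
      ext v
      simp
    have := congrArg (LinearMap.trace ℂ (Fin n → ℂ)) this
    rw [Finset.mul_sum, map_sum, map_smul] at this
    simpa [Representation.character] using this
  rw [h2]
  linear_combination (-ρ.character x) * h1

theorem Representation.IsIrreducible.degree_eq_one_of_commute (hρ : ρ.IsIrreducible)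
    (hcomm : ∀ g h, ρ g * ρ h = ρ h * ρ g) : n = 1 := by
  have hscal : ∀ g, ∃ c : ℂ, ρ g = c • LinearMap.id := fun g =>
    hρ.exists_eq_smul_one (ρ g) fun h => hcomm g h
  have : NeZero n := ⟨hρ.ne_zero⟩
  let v : Fin n → ℂ := fun _ => 1
  have hv : v ≠ 0 := fun h => one_ne_zero (congrFun h 0)
  rcases hρ.submodule_eq_bot_or_eq_top (ℂ ∙ v) (by
    intro g w hw
    obtain ⟨c, hc⟩ := hscal g
    rw [hc]
    exact Submodule.smul_mem _ c hw) with h | h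
  · exact absurd (Submodule.span_singleton_eq_bot.mp h) hv
  · have h1 := finrank_span_singleton (K := ℂ) hv
    rw [h, finrank_top] at h1
    simpa using h1

/-- If `G ⧸ N` is abelian and the coset `zN` lies in a single conjugacy class, then every
irreducible character of degree greater than one vanishes at `z`. -/
theorem Representation.IsIrreducible.character_eq_zero_of_coset_conj [Finite G]
    (hρ : ρ.IsIrreducible)
    (hn : n ≠ 1) (N : Subgroup G) [N.Normal] (hN : commutator G ≤ N) (z : G)
    (hz : ∀ d ∈ N, IsConj z (z * d)) : ρ.character z = 0 := by
  classical
  have : Fintype G := Fintype.ofFinite G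
  let W : Submodule ℂ (Fin n → ℂ) := Representation.invariants (ρ.comp N.subtype)
  -- The N-invariants are G-stable. If they are 0, then ∑ ρ(d) over N vanishes, and the trace of
  -- ρ(z) times it is |N| χ(z). If they are everything, G acts through an abelian quotient.
  rcases hρ.submodule_eq_bot_or_eq_top W (fun g => Representation.le_comap_invariants ρ N g) with h | h
  · have hE : ∑ d : N, ρ (d : G) = 0 := by
      refine LinearMap.ext fun v => ?_
      have hmem : (∑ d : N, ρ (d : G)) v ∈ W := by
        intro e
        rw [← Module.End.mul_apply, Finset.mul_sum]
        congr 1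
        refine Fintype.sum_equiv (Equiv.mulLeft e) _ _ fun d => ?_
        simp
      rw [h] at hmem
      rw [(Submodule.mem_bot ℂ).mp hmem]
      rfl
    have h1 := congrArg (fun T => LinearMap.trace ℂ (Fin n → ℂ) (ρ z * T)) hE
    simp only [Finset.mul_sum, map_sum, mul_zero, map_zero, ← map_mul] at h1
    have h2 : ∀ d : N, LinearMap.trace ℂ (Fin n → ℂ) (ρ (z * d)) = ρ.character z := by
      intro d
      obtain ⟨c, hc⟩ := isConj_iff.mp (hz d d.2)
      rw [← hc]
      exact Representation.char_conj ρ z c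
    simpa only [h2, Finset.sum_const, Finset.card_univ, nsmul_eq_mul, mul_eq_zero,
      Nat.cast_eq_zero, Fintype.card_ne_zero, false_or] using h1
  · exfalso
    apply hn
    have htriv : ∀ d ∈ N, ρ d = 1 := by
      intro d hd
      refine LinearMap.ext fun v => ?_
      have : v ∈ W := h ▸ Submodule.mem_top
      exact this ⟨d, hd⟩
    apply hρ.degree_eq_one_of_commute
    intro g k
    have h1 : ρ (g * k) = ρ (k * g) := by
      have h3 : g * k = (k * g) * ⁅g⁻¹, k⁻¹⁆ := by
        simp [commutatorElement_def, mul_assoc]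
      rw [h3, map_mul ρ (k * g), htriv ⁅g⁻¹, k⁻¹⁆, mul_one]
      exact hN (Subgroup.commutator_mem_commutator (Subgroup.mem_top _) (Subgroup.mem_top _))
    rwa [map_mul, map_mul] at h1

/-- The Q-invariants have dimension |Q|⁻¹ ∑ χ over Q, which here is n/|Q|. -/
theorem Representation.card_dvd_degree_of_character_eq_zero [Finite G] (Q : Subgroup G)
    (hQ : ∀ x ∈ Q, x ≠ 1 → ρ.character x = 0) : Nat.card Q ∣ n := by
  classical
  have : Fintype Q := Fintype.ofFinite Q
  have hcard : (Nat.card Q : ℂ) ≠ 0 := by exact_mod_cast Nat.card_pos.ne'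
  have : Invertible (Nat.card Q : ℂ) := invertibleOfNonzero hcard
  have h := Representation.card_inv_mul_sum_char_eq_finrank (ρ.comp Q.subtype)
  have h2 : ∑ g : Q, Representation.character (ρ.comp Q.subtype) g = n := by
    rw [Finset.sum_eq_single 1]
    · simp
    · intro b _ hb
      exact hQ b b.2 (by simpa using hb)
    · simp
  rw [h2, inv_mul_eq_iff_eq_mul₀ hcard] at h
  exact ⟨_, by exact_mod_cast h⟩

end Representation

/-! ### Column orthogonality from the Wedderburn decomposition -/

theorem Matrix.stdBasis_repr_apply {R m n : Type*} [Semiring R] [Fintype m] [Fintype n]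
    (M : Matrix m n R) (i : m) (j : n) : (Matrix.stdBasis R m n).repr M (i, j) = M i j := by
  simp [Matrix.stdBasis]

/-- Column orthogonality, for a list of irreducible representations obtained from the
Wedderburn decomposition of the group algebra. -/
theorem exists_irreducible_family_column_orthogonality (G : Type*) [Group G] [Finite G] :
    ∃ (k : ℕ) (d : Fin k → ℕ) (ρ : ∀ i, Representation ℂ G (Fin (d i) → ℂ)),
      (∀ i, (ρ i).IsIrreducible) ∧ ∀ z w : G,
        ∑ i, (ρ i).character z * (ρ i).character w⁻¹ = Nat.card {g : G // z * g = g * w} := by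
  classical
  have : Fintype G := Fintype.ofFinite G
  have : NeZero (Nat.card G : ℂ) := ⟨by exact_mod_cast Nat.card_pos.ne'⟩
  obtain ⟨k, d, hd, ⟨φ⟩⟩ :=
    IsSemisimpleRing.exists_algEquiv_pi_matrix_of_isAlgClosed ℂ (MonoidAlgebra ℂ G)
  let ψ : ∀ i, MonoidAlgebra ℂ G →ₐ[ℂ] Matrix (Fin (d i)) (Fin (d i)) ℂ := fun i =>
    (Pi.evalAlgHom ℂ (fun i => Matrix (Fin (d i)) (Fin (d i)) ℂ) i).comp φ.toAlgHom
  have hψ : ∀ i, Function.Surjective (ψ i) := fun i =>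
    (Function.surjective_eval i).comp φ.surjective
  let ρ : ∀ i, Representation ℂ G (Fin (d i) → ℂ) := fun i =>
    ((Matrix.toLinAlgEquiv' : Matrix (Fin (d i)) (Fin (d i)) ℂ ≃ₐ[ℂ] _).toAlgHom.comp
      (ψ i)).toMonoidHom.comp (MonoidAlgebra.of ℂ G)
  have hρ : ∀ i g, ρ i g = Matrix.toLin' (ψ i (MonoidAlgebra.of ℂ G g)) := fun i g => rfl
  have hχ : ∀ i g, (ρ i).character g = (ψ i (MonoidAlgebra.of ℂ G g)).trace := fun i g => by
    rw [Representation.character, hρ, Matrix.trace_toLin'_eq]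
  refine ⟨k, d, ρ, fun i => ?_, fun z w => ?_⟩
  · refine Representation.isIrreducible_of_forall (hd i).out fun W hW => ?_
    have hall : ∀ M : Matrix (Fin (d i)) (Fin (d i)) ℂ, ∀ v ∈ W, Matrix.toLin' M v ∈ W := by
      intro M v hv
      obtain ⟨a, rfl⟩ := hψ i M
      induction a using MonoidAlgebra.induction_on with
      | of g => exact hW g v hv
      | add a b ha hb =>
        rw [map_add, map_add]
        exact W.add_mem ha hb
      | smul r a ha =>
        rw [map_smul, map_smul]
        exact W.smul_mem r ha
    rcases eq_or_ne W ⊥ with h | h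
    · exact Or.inl h
    · right
      obtain ⟨v, hv, hv0⟩ := W.exists_mem_ne_zero_of_ne_bot h
      obtain ⟨j, hj⟩ := Function.ne_iff.mp hv0
      rw [eq_top_iff]
      intro u _
      -- This rank one matrix sends v to u, so W contains every vector.
      have := hall (Matrix.vecMulVec u (Pi.single j (v j)⁻¹)) v hv
      convert this
      have hj' : v j ≠ 0 := hj
      ext a
      rw [Matrix.toLin'_apply, Matrix.vecMulVec_mulVec, single_dotProduct, inv_mul_cancel₀ hj']
      simp
  -- Compute the trace of a ↦ z a w⁻¹ twice: the group basis counts the g with z g w⁻¹ = g, and the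
  -- matrix units of block i contribute χᵢ(z) χᵢ(w⁻¹).
  · let T : MonoidAlgebra ℂ G →ₗ[ℂ] MonoidAlgebra ℂ G :=
      LinearMap.mulLeft ℂ (MonoidAlgebra.of ℂ G z) ∘ₗ
        LinearMap.mulRight ℂ (MonoidAlgebra.of ℂ G w⁻¹)
    have h1 : LinearMap.trace ℂ _ T = Nat.card {g : G // z * g = g * w} := by
      rw [LinearMap.trace_eq_matrix_trace ℂ (MonoidAlgebra.basis G ℂ)]
      have : ∀ g : G, LinearMap.toMatrix (MonoidAlgebra.basis G ℂ) (MonoidAlgebra.basis G ℂ) T g g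
          = if z * g = g * w then 1 else 0 := by
        intro g
        have h2 : z * (g * w⁻¹) = g ↔ z * g = g * w := by
          rw [← mul_assoc, mul_inv_eq_iff_eq_mul]
        simp [LinearMap.toMatrix_apply, T, MonoidAlgebra.basis, MonoidAlgebra.single_mul_single, Finsupp.single_apply, h2]
      simp [Matrix.trace, this, Nat.card_eq_fintype_card, Fintype.card_subtype]
    let S : (∀ i, Matrix (Fin (d i)) (Fin (d i)) ℂ) →ₗ[ℂ] (∀ i, Matrix (Fin (d i)) (Fin (d i)) ℂ) :=
      LinearMap.mulLeft ℂ (φ (MonoidAlgebra.of ℂ G z)) ∘ₗ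
        LinearMap.mulRight ℂ (φ (MonoidAlgebra.of ℂ G w⁻¹))
    have h2 : LinearMap.trace ℂ _ S = LinearMap.trace ℂ _ T := by
      rw [← LinearMap.trace_conj' T φ.toLinearEquiv]
      congr 1
      refine LinearMap.ext fun M => ?_
      simp [S, T, LinearEquiv.conj_apply]
    rw [← h1, ← h2]
    let b := Pi.basis (fun i => Matrix.stdBasis ℂ (Fin (d i)) (Fin (d i)))
    rw [LinearMap.trace_eq_matrix_trace ℂ b, Matrix.trace, Fintype.sum_sigma]
    refine Finset.sum_congr rfl fun i _ => ?_
    rw [hχ, hχ, Matrix.trace, Matrix.trace, Finset.sum_mul_sum, Fintype.sum_prod_type]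
    refine Finset.sum_congr rfl fun a _ => Finset.sum_congr rfl fun c _ => ?_
    simp only [Matrix.diag_apply, LinearMap.toMatrix_apply, b, Pi.basis_apply, Pi.basis_repr]
    simp [S, Matrix.stdBasis_eq_single, Matrix.stdBasis_repr_apply, ψ, Matrix.mul_apply,
      Matrix.single_apply, ite_and]

/-! ### Abelian groups acting without fixed points are cyclic -/

section FrobeniusComplement

/-- Acting by c permutes the factors cyclically, so the product is a fixed point. -/
theorem prod_pow_smul_eq_one {A V : Type*} [Group A] [CommGroup V] [MulDistribMulAction A V]
    {q : ℕ} {c : A} (hc : c ^ q = 1) (hfix : ∀ v : V, c • v = v → v = 1) (v : V) :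
    ∏ j ∈ Finset.range q, c ^ j • v = 1 := by
  apply hfix
  rw [Finset.smul_prod']
  have h1 := Finset.prod_range_succ (fun j => c ^ j • v) q
  have h2 := Finset.prod_range_succ' (fun j => c ^ j • v) q
  rw [h1, hc, pow_zero, mul_left_inj] at h2
  rw [h2]
  simp [pow_succ', mul_smul]

/-- An elementary abelian group of order `q²` cannot act without nontrivial fixed points on
an abelian group without elements of order `q`. -/
theorem mem_zpowers_of_fixedPointFree {A V : Type*} [Group A] [CommGroup V] [Nontrivial V]
    [MulDistribMulAction A V] (hfix : ∀ g : A, g ≠ 1 → ∀ v : V, g • v = v → v = 1)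
    {q : ℕ} (hq : q.Prime) (hV : ∀ v : V, v ^ q = 1 → v = 1) {a b : A} (hab : Commute a b)
    (ha : a ^ q = 1) (hb : b ^ q = 1) (hb1 : b ≠ 1) : a ∈ Subgroup.zpowers b := by
  have : Fact q.Prime := ⟨hq⟩
  by_contra hmem
  obtain ⟨v, hv⟩ := exists_ne (1 : V)
  apply hv
  apply hV
  -- Multiply these relations over i < q. The j = 0 factors give v ^ q; for 0 < j < q the factors
  -- form a translate product over the powers of b ^ j, which is trivial. Hence v ^ q = 1.
  have h1 : ∀ i, ∏ j ∈ Finset.range q, (a * b ^ i) ^ j • v = 1 := by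
    intro i
    apply prod_pow_smul_eq_one
    · rw [(hab.pow_right i).mul_pow, ha, ← pow_mul, mul_comm i, pow_mul, hb, one_pow, one_mul]
    · apply hfix
      intro h
      apply hmem
      rw [eq_inv_of_mul_eq_one_left h]
      exact inv_mem (pow_mem (Subgroup.mem_zpowers b) i)
  have h2 : ∏ j ∈ Finset.range q, ∏ i ∈ Finset.range q, (a * b ^ i) ^ j • v = 1 := by
    rw [Finset.prod_comm]
    exact Finset.prod_eq_one fun i _ => h1 i
  rw [← h2, Finset.prod_eq_single 0]
  · simp
  · intro j hj hj0
    have h3 : ∀ i, (a * b ^ i) ^ j • v = (b ^ j) ^ i • (a ^ j • v) := by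
      intro i
      rw [(hab.pow_right i).mul_pow, ← mul_smul, ← pow_mul, ← pow_mul, mul_comm i j,
        (hab.pow_pow j (j * i)).eq]
    simp only [h3]
    apply prod_pow_smul_eq_one
    · rw [← pow_mul, mul_comm, pow_mul, hb, one_pow]
    · apply hfix
      intro h
      have h4 : orderOf b = q := orderOf_eq_prime hb hb1
      have h5 := Nat.le_of_dvd (Nat.pos_of_ne_zero hj0) (orderOf_dvd_of_pow_eq_one h)
      rw [h4] at h5
      exact absurd (Finset.mem_range.mp hj) (not_lt.mpr h5)
  · intro h
    exact absurd (Finset.mem_range.mpr hq.pos) h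

/-- It suffices that a ^ n = 1 has at most n solutions. The hypothesis settles prime n, and the
bound is multiplicative because each nonempty fibre of a ↦ a ^ m is a translate of the m-torsion. -/
theorem isCyclic_of_forall_prime_mem_zpowers {A : Type*} [CommGroup A] [Finite A]
    (h : ∀ q : ℕ, q.Prime → ∀ a b : A, a ^ q = 1 → b ^ q = 1 → b ≠ 1 → a ∈ Subgroup.zpowers b) :
    IsCyclic A := by
  classical
  have : Fintype A := Fintype.ofFinite A
  refine isCyclic_of_card_pow_eq_one_le fun n hn => ?_
  induction n using Nat.recOnMul with
  | zero => exact absurd hn (lt_irrefl 0)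
  | one =>
    have : (Finset.univ.filter fun a : A => a ^ 1 = 1) ⊆ {1} := by
      intro a ha
      simpa using ha
    exact (Finset.card_le_card this).trans (by simp)
  | prime q hq =>
    have : Fact q.Prime := ⟨hq⟩
    by_cases hb : ∃ b : A, b ^ q = 1 ∧ b ≠ 1
    · obtain ⟨b, hb, hb1⟩ := hb
      have hsub : (Finset.univ.filter fun a : A => a ^ q = 1) ⊆
          Finset.univ.filter fun a : A => a ∈ Subgroup.zpowers b := by
        intro a ha
        simp only [Finset.mem_filter, Finset.mem_univ, true_and] at ha ⊢
        exact h q hq a b ha hb hb1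
      refine (Finset.card_le_card hsub).trans ?_
      rw [← Fintype.card_subtype]
      have := Fintype.card_zpowers (x := b)
      rw [orderOf_eq_prime hb hb1] at this
      exact this.le
    · push Not at hb
      have hsub : (Finset.univ.filter fun a : A => a ^ q = 1) ⊆ {1} := by
        intro a ha
        simp only [Finset.mem_filter, Finset.mem_univ, true_and] at ha
        simpa using hb a ha
      exact (Finset.card_le_card hsub).trans (by simpa using hq.one_le)
  | mul m n ihm ihn =>
    have hm0 : 0 < m := Nat.pos_of_mul_pos_right hn
    have hn0 : 0 < n := Nat.pos_of_mul_pos_left hn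
    have := Finset.card_le_mul_card_image_of_maps_to (f := fun a : A => a ^ m)
      (s := Finset.univ.filter fun a : A => a ^ (m * n) = 1)
      (t := Finset.univ.filter fun a : A => a ^ n = 1) (fun a ha => by simpa [pow_mul] using ha) m
      (fun b _ => by
        rcases Finset.eq_empty_or_nonempty ((Finset.univ.filter fun a : A => a ^ (m * n) = 1).filter
          fun a => a ^ m = b) with h | ⟨c, hc⟩
        · rw [h]
          simp
        · refine le_trans ?_ (ihm hm0)
          refine Finset.card_le_card_of_injOn (fun a => a * c⁻¹) ?_ ?_
          · intro a ha
            simp only [Finset.coe_filter, Finset.mem_filter, Finset.mem_univ, true_and,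
              Set.mem_ofPred_eq] at ha hc ⊢
            rw [mul_pow, inv_pow, ha.2, hc.2, mul_inv_cancel]
          · intro a _ a' _ haa
            exact mul_right_cancel haa)
    exact this.trans (Nat.mul_le_mul_left m (ihn hn0))

/-- An abelian Frobenius complement is cyclic. -/
theorem isCyclic_of_fixedPointFree {A N : Type*} [CommGroup A] [Finite A] [Group N] [Finite N]
    [Nontrivial N] [MulDistribMulAction A N]
    (hfix : ∀ g : A, g ≠ 1 → ∀ v : N, g • v = v → v = 1) : IsCyclic A := by
  refine isCyclic_of_forall_prime_mem_zpowers fun q hq a b ha hb hb1 => ?_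
  have : Fact q.Prime := ⟨hq⟩
  let Q : Subgroup A := (powMonoidHom q : A →* A).ker
  have hQ : IsPGroup q Q := fun g => ⟨1, by
    ext
    rw [pow_one]
    exact g.2⟩
  -- The q-group Q, the q-torsion of A, fixes only 1, so |N| ≡ 1 mod q.
  have hqN : ¬ q ∣ Nat.card N := by
    intro hdvd
    have h1 := hQ.card_modEq_card_fixedPoints N
    have h2 : MulAction.fixedPoints Q N = {1} := by
      ext v
      constructor
      · intro hv
        exact hfix b hb1 v (hv ⟨b, hb⟩)
      · rintro rfl g
        exact smul_one g
    rw [h2] at h1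
    have h3 : Nat.card N ≡ 0 [MOD q] := Nat.modEq_zero_iff_dvd.mpr hdvd
    have h4 := h1.symm.trans h3
    simp only [Nat.card_eq_fintype_card, Fintype.card_unique] at h4
    exact hq.one_lt.ne' (Nat.dvd_one.mp (Nat.modEq_zero_iff_dvd.mp h4))
  let r := (Nat.card N).minFac
  have hr : r.Prime := Nat.minFac_prime Finite.one_lt_card.ne'
  have : Fact r.Prime := ⟨hr⟩
  -- The number of Sylow r-subgroups is prime to q, so Q stabilizes one of them; its centre is a
  -- nontrivial abelian group on which Q acts, which reduces to the abelian case.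
  have hSyl : ¬ q ∣ Nat.card (Sylow r N) := fun h => hqN <| by
    have P : Sylow r N := default
    exact h.trans (P.card_dvd_index.trans P.toSubgroup.index_dvd_card)
  obtain ⟨R, hR⟩ := hQ.nonempty_fixed_point_of_prime_not_dvd_card (Sylow r N) hSyl
  obtain ⟨R, hRp, hRnt, hRmem⟩ : ∃ R : Subgroup N, IsPGroup r R ∧ Nontrivial R ∧
      ∀ g : Q, ∀ v ∈ R, g • v ∈ R := by
    refine ⟨R.toSubgroup, R.2, ?_, ?_⟩
    · apply (Subgroup.nontrivial_iff_ne_bot R.toSubgroup).mpr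
      exact R.ne_bot_of_dvd_card (Nat.minFac_dvd _)
    · intro g v hv
      have h1 : g • v ∈ g • R.toSubgroup := Subgroup.smul_mem_pointwise_smul v g R.toSubgroup hv
      have h2 : g • R.toSubgroup = R.toSubgroup := congrArg Sylow.toSubgroup (hR g)
      exact h2 ▸ h1
  have hVnt : Nontrivial (Subgroup.center R) := hRp.center_nontrivial
  let _ : CommGroup (Subgroup.center R) :=
    { (inferInstance : Group (Subgroup.center R)) with
      mul_comm := fun v w => by
        ext1
        exact (Subgroup.mem_center_iff.mp v.2 w).symm }
  let _ : MulDistribMulAction Q (Subgroup.center R) :=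
    { smul := fun g v => ⟨⟨g • (v : R), hRmem g _ v.1.2⟩, by
        rw [Subgroup.mem_center_iff]
        intro w
        have h1 := Subgroup.mem_center_iff.mp v.2 ⟨g⁻¹ • (w : N), hRmem g⁻¹ _ w.2⟩
        have h2 := congrArg (fun x : R => g • (x : N)) h1
        ext
        simpa using h2⟩
      one_smul := fun v => by
        ext
        exact one_smul Q _
      mul_smul := fun g h v => by
        ext
        exact mul_smul g h _
      smul_mul := fun g v w => by
        ext
        exact smul_mul' g _ _
      smul_one := fun g => by
        ext
        exact smul_one g }
  have hsmul : ∀ (g : Q) (v : Subgroup.center R), (((g • v : Subgroup.center R) : R) : N) =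
    g • ((v : R) : N) := fun _ _ => rfl
  have key := mem_zpowers_of_fixedPointFree (A := Q) (V := Subgroup.center R)
    (fun g hg v hv => by
      have := hfix g (by simpa using hg) ((v : R) : N) (by
        have := congrArg (fun x : Subgroup.center R => ((x : R) : N)) hv
        exact this)
      ext
      exact this) hq
    (fun v hv => by
      have h1 : ((v : R) : N) ^ q = 1 := by
        have := congrArg (fun x : Subgroup.center R => ((x : R) : N)) hv
        simpa using this
      ext
      have h2 := orderOf_dvd_of_pow_eq_one h1
      rcases (Nat.dvd_prime hq).mp h2 with h | h
      · exact orderOf_eq_one_iff.mp h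
      · exact absurd (h ▸ orderOf_dvd_natCard _) hqN)
    (a := ⟨a, ha⟩) (b := ⟨b, hb⟩) (mul_comm _ _) (by ext; exact ha) (by ext; exact hb)
    (fun h => hb1 (congrArg Subtype.val h))
  obtain ⟨k, hk⟩ := key
  exact ⟨k, congrArg Subtype.val hk⟩

end FrobeniusComplement

/-! ### Fixed-point-free action, conjugate cosets, and the Frobenius structure -/

section FrobeniusStructure

open scoped commutatorElement

variable {G : Type*} [Group G]

/-- If no nonidentity element of the normal subgroup `D` commutes with `u`, then every element of
`D` has the form `u⁻¹ (d u d⁻¹)`. -/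
theorem exists_inv_mul_conj_eq [Finite G] (D : Subgroup G) [hD : D.Normal] {u : G}
    (hu : ∀ d ∈ D, u * d = d * u → d = 1) {e : G} (he : e ∈ D) :
    ∃ d ∈ D, u⁻¹ * (d * u * d⁻¹) = e := by
  let f : D → D := fun d => ⟨u⁻¹ * (d * u * (d : G)⁻¹), by
    have h1 : u⁻¹ * (d * u * (d : G)⁻¹) = (u⁻¹ * d * u⁻¹⁻¹) * (d : G)⁻¹ := by group
    rw [h1]
    exact D.mul_mem (hD.conj_mem _ d.2 _) (D.inv_mem d.2)⟩
  -- Equal values at d and d' make d'⁻¹ d commute with u; injectivity on the finite set D then gives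
  -- surjectivity.
  have hf : Function.Injective f := by
    intro d d' h
    have h1 : u⁻¹ * (d * u * (d : G)⁻¹) = u⁻¹ * (d' * u * (d' : G)⁻¹) := congrArg Subtype.val h
    have h2 := mul_left_cancel h1
    have h3 : (d' : G)⁻¹ * d = 1 := by
      apply hu _ (D.mul_mem (D.inv_mem d'.2) d.2)
      have h4 : u = (d' : G)⁻¹ * (d * u * (d : G)⁻¹) * d' := by
        rw [h2]
        group
      calc u * ((d' : G)⁻¹ * d) = ((d' : G)⁻¹ * (d * u * (d : G)⁻¹) * d') * ((d' : G)⁻¹ * d) := by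
            rw [← h4]
        _ = (d' : G)⁻¹ * d * u := by group
    ext
    exact (inv_mul_eq_one.mp h3).symm
  obtain ⟨d, hd⟩ := (Finite.injective_iff_surjective.mp hf) ⟨e, he⟩
  exact ⟨d, d.2, congrArg Subtype.val hd⟩

theorem isConj_mul_of_fixedPointFree [Finite G] (D : Subgroup G) [D.Normal] {u : G}
    (hu : ∀ d ∈ D, u * d = d * u → d = 1) {e : G} (he : e ∈ D) : IsConj u (u * e) := by
  obtain ⟨d, -, hd⟩ := exists_inv_mul_conj_eq D hu he
  refine isConj_iff.mpr ⟨d, ?_⟩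
  rw [← hd, mul_inv_cancel_left]

/-- If the coset `z D` is contained in the conjugacy class of `z` and the order of `z` is prime to
`|D|`, then `z` centralizes no nonidentity element of `D`. -/
theorem eq_one_of_commute_of_coset_conj [Finite G] (D : Subgroup G) {z : G}
    (hz : ∀ d ∈ D, IsConj z (z * d)) (hcop : (orderOf z).Coprime (Nat.card D)) {d : G}
    (hd : d ∈ D) (hzd : z * d = d * z) : d = 1 := by
  obtain ⟨c, hc⟩ := isConj_iff.mp (hz d hd)
  -- Conjugacy preserves the order, whereas for commuting elements of coprime order the orders
  -- multiply.
  have h1 : orderOf (z * d) = orderOf z := by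
    rw [← hc, ← MulAut.conj_apply]
    exact MulEquiv.orderOf_eq (MulAut.conj c) z
  have hcd : (orderOf z).Coprime (orderOf d) := by
    have := orderOf_dvd_natCard (⟨d, hd⟩ : D)
    rw [Subgroup.orderOf_mk] at this
    exact hcop.coprime_dvd_right this
  have h2 : orderOf (z * d) = orderOf z * orderOf d := Commute.orderOf_mul_eq_mul_orderOf_of_coprime hzd hcd
  rw [h1] at h2
  have h3 : orderOf d = 1 := by
    have := orderOf_pos z
    nlinarith
  exact orderOf_eq_one_iff.mp h3

theorem exists_pow_orderOf_prime [Finite G] {a : G} (ha : a ≠ 1) :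
    ∃ m, (orderOf (a ^ m)).Prime := by
  have h1 : orderOf a ≠ 1 := fun h => ha (orderOf_eq_one_iff.mp h)
  have hp := Nat.minFac_prime h1
  refine ⟨orderOf a / (orderOf a).minFac, ?_⟩
  rw [orderOf_pow_orderOf_div (orderOf_pos a).ne' (Nat.minFac_dvd _)]
  exact hp

theorem commutator_le_iff_forall_commutatorElement_mem {D : Subgroup G} :
    commutator G ≤ D ↔ ∀ a b : G, ⁅a, b⁆ ∈ D := by
  rw [commutator_def, Subgroup.commutator_le]
  simp

theorem commutatorElement_mem_commutator (a b : G) : ⁅a, b⁆ ∈ commutator G :=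
  commutator_le_iff_forall_commutatorElement_mem.mp le_rfl a b

/-- A complement of a normal subgroup containing the commutator subgroup, all of whose elements of
prime order act without nontrivial fixed points on the commutator subgroup. -/
theorem hasFrobeniusStructure_of_isComplement [Finite G] {A H : Subgroup G} [hH : H.Normal]
    (hnonab : commutator G ≠ ⊥) (hle : commutator G ≤ H) (hA : A ≠ ⊥) (hcompl : A.IsComplement' H)
    (hfix : ∀ a ∈ A, (orderOf a).Prime → ∀ d ∈ commutator G, a * d = d * a → d = 1) :
    HasFrobeniusStructure A H := by
  have hfix' : ∀ a ∈ A, a ≠ 1 → ∀ d ∈ commutator G, a * d = d * a → d = 1 := by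
    intro a ha ha1 d hd had
    obtain ⟨m, hm⟩ := exists_pow_orderOf_prime ha1
    exact hfix _ (A.pow_mem ha m) hm d hd ((show Commute a d from had).pow_left m)
  have hcommA : ∀ a ∈ A, ∀ b ∈ A, a * b = b * a := by
    intro a ha b hb
    rw [← commutatorElement_eq_one_iff_mul_comm]
    have h1 : ⁅a, b⁆ ∈ A ⊓ H := ⟨A.mul_mem (A.mul_mem (A.mul_mem ha hb) (A.inv_mem ha))
      (A.inv_mem hb), hle (commutatorElement_mem_commutator a b)⟩
    rwa [hcompl.disjoint.eq_bot, Subgroup.mem_bot] at h1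
  obtain ⟨⟨y, hy⟩, hy1⟩ := Subgroup.ne_bot_iff_exists_ne_one.mp hA
  replace hy1 : y ≠ 1 := fun h => hy1 (Subtype.ext h)
  have hyfix := hfix' y hy hy1
  -- A commutator of elements of C_G(y) lies in G' and commutes with y, hence is trivial.
  have hcommC : ∀ a b : G, a * y = y * a → b * y = y * b → a * b = b * a := by
    intro a b ha hb
    rw [← commutatorElement_eq_one_iff_mul_comm]
    apply hyfix _ (commutatorElement_mem_commutator a b)
    have hca : Commute y a := ha.symm
    have hcb : Commute y b := hb.symm
    exact (((hca.mul_right hcb).mul_right hca.inv_right).mul_right hcb.inv_right).eq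
  -- G = C_G(y) G': the conjugate of y by g equals its conjugate by some d ∈ G', so d⁻¹ g
  -- centralizes y.
  have hdecomp : ∀ g : G, ∃ c d, d ∈ commutator G ∧ c * y = y * c ∧ g = c * d := by
    intro g
    obtain ⟨d, hd, he⟩ := exists_inv_mul_conj_eq (commutator G) hyfix
      (e := y⁻¹ * (g * y * g⁻¹)) (by
        have := commutatorElement_mem_commutator y⁻¹ g
        rw [commutatorElement_def] at this
        convert this using 1
        group)
    have h1 := mul_left_cancel he
    refine ⟨d⁻¹ * g, (d⁻¹ * g)⁻¹ * d * (d⁻¹ * g), ?_, ?_, by group⟩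
    · have := (inferInstance : (commutator G).Normal).conj_mem d hd (d⁻¹ * g)⁻¹
      simpa using this
    · have h2 : g * y = d * y * d⁻¹ * g := by
        rw [h1]
        group
      rw [mul_assoc, h2]
      group
  have hcomm_eq : ⁅H, A⁆ = commutator G := by
    apply le_antisymm
    · exact Subgroup.commutator_mono le_top le_top
    · intro e he
      obtain ⟨d, hd, rfl⟩ := exists_inv_mul_conj_eq (commutator G) hyfix he
      rw [Subgroup.commutator_comm]
      have := Subgroup.commutator_mem_commutator (A.inv_mem hy) (hle hd)
      rw [commutatorElement_def] at this
      convert this using 1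
      group
  have hCy : ∀ c ∈ centralizerIn H A, c * y = y * c := fun c hc =>
    (Subgroup.mem_centralizer_iff.mp hc.2 y hy).symm
  have hcyclic : IsCyclic A := by
    let _ : CommGroup A := { (inferInstance : Group A) with
      mul_comm := fun a b => Subtype.ext (hcommA a a.2 b b.2) }
    have : Nontrivial (commutator G) := (Subgroup.nontrivial_iff_ne_bot _).mpr hnonab
    let _ : MulDistribMulAction A (commutator G) :=
      MulDistribMulAction.compHom _ ((MulAut.conjNormal (H := commutator G)).comp A.subtype)
    apply isCyclic_of_fixedPointFree (N := commutator G)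
    intro a ha d had
    have h1 : (a : G) * d * (a : G)⁻¹ = d := congrArg Subtype.val had
    ext
    exact hfix' a a.2 (by simpa using ha) d d.2 (mul_inv_eq_iff_eq_mul.mp h1)
  refine ⟨hcompl.mul_eq, hA, hcyclic, hH, ?_, ?_, ?_, ?_, ?_⟩
  · rw [hcomm_eq]
    ext h
    constructor
    · rintro ⟨c, hc, d, hd, rfl⟩
      exact H.mul_mem hc.1 (hle hd)
    · intro hh
      obtain ⟨c, d, hd, hc, rfl⟩ := hdecomp h
      refine ⟨c, ⟨?_, ?_⟩, d, hd, rfl⟩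
      · exact (H.mul_mem_cancel_right (hle hd)).mp hh
      · refine Subgroup.mem_centralizer_iff.mpr ?_
        intro a ha
        -- C_G(y) is abelian and contains A, so centralizing the single element y already means
        -- centralizing A.
        exact hcommC a c (hcommA a ha y hy) hc
  · intro a ha b hb
    exact hcommC a b (hCy a ha) (hCy b hb)
  · rw [hcomm_eq]
    infer_instance
  · rw [hcomm_eq, eq_bot_iff]
    rintro c ⟨hc, hc'⟩
    exact hyfix c hc' (hCy c hc).symm
  · rw [hcomm_eq]
    refine ⟨?_, fun a ha ha1 d hd hd1 h => hd1 (hfix' a ha ha1 d hd (mul_inv_eq_iff_eq_mul.mp h))⟩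
    rw [Subgroup.normalizer_eq_top]
    exact le_top

/-- In a group with a Frobenius structure, cosets of `[H, A]` outside `H` lie in single conjugacy
classes, provided that `H` is a Hall subgroup. -/
theorem HasFrobeniusStructure.isConj_mul [Finite G] {A H : Subgroup G} (h : HasFrobeniusStructure A H)
    (hcop : (Nat.card H).Coprime H.index) {z : G} (hz : z ∉ H) {e : G} (he : e ∈ ⁅H, A⁆) :
    IsConj z (z * e) := by
  have := h.normal
  have hD := h.normal_D
  obtain ⟨a, ha, k, hk, hak⟩ : z ∈ (A : Set G) * (H : Set G) := h.eq_mul ▸ Set.mem_univ z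
  obtain ⟨c, hc, d, hd, hcd⟩ : k ∈ (centralizerIn H A : Set G) * ((⁅H, A⁆ : Subgroup G) : Set G) :=
    h.eq_CD ▸ hk
  simp only at hak hcd
  subst hcd hak
  have hcomm : Commute a c := Subgroup.mem_centralizer_iff.mp hc.2 a ha
  have haH : a ∉ H := fun haH => hz (H.mul_mem haH hk)
  -- The order of a modulo H divides the index, which is prime to |H|.
  have hapow : a ^ Nat.card H ∉ H := by
    intro hmem
    apply haH
    have h1 : (QuotientGroup.mk' H a) ^ Nat.card H = 1 := by
      rw [← map_pow]
      exact (QuotientGroup.eq_one_iff _).mpr hmem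
    have h2 : orderOf (QuotientGroup.mk' H a) ∣ H.index := orderOf_dvd_natCard _
    have h3 := Nat.Coprime.eq_one_of_dvd (hcop.symm.coprime_dvd_left h2)
      (orderOf_dvd_of_pow_eq_one h1)
    exact (QuotientGroup.eq_one_iff _).mp (orderOf_eq_one_iff.mp h3)
  have hcpow : c ^ Nat.card H = 1 := by
    have := pow_card_eq_one' (x := (⟨c, hc.1⟩ : H))
    exact congrArg Subtype.val this
  -- Raising a c to the power |H| kills c and leaves a nonidentity element of A, which acts freely.
  have hfix : ∀ x ∈ ⁅H, A⁆, a * c * x = x * (a * c) → x = 1 := by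
    intro x hx hxe
    by_contra hx1
    have h1 : Commute ((a * c) ^ Nat.card H) x := (show Commute (a * c) x from hxe).pow_left _
    rw [hcomm.mul_pow, hcpow, mul_one] at h1
    exact h.frobenius.2 _ (A.pow_mem ha _) (fun h0 => hapow (h0 ▸ H.one_mem)) x hx hx1
      (mul_inv_eq_iff_eq_mul.mpr h1)
  -- Both z = a c d and z e are conjugate to a c.
  have h1 := isConj_mul_of_fixedPointFree ⁅H, A⁆ hfix hd
  have h2 := isConj_mul_of_fixedPointFree ⁅H, A⁆ hfix ((⁅H, A⁆).mul_mem hd he)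
  simp only [← mul_assoc] at h2 ⊢
  exact h1.symm.trans h2

/-- Modulo D, G is the product of the commuting abelian subgroups A and C. -/
theorem HasFrobeniusStructure.commutator_le {A H : Subgroup G} (h : HasFrobeniusStructure A H) :
    commutator G ≤ ⁅H, A⁆ := by
  have := h.normal
  have hD := h.normal_D
  have := h.isCyclic
  have hdecomp : ∀ g : G, ∃ a ∈ A, ∃ c ∈ centralizerIn H A,
      QuotientGroup.mk' ⁅H, A⁆ g = QuotientGroup.mk' ⁅H, A⁆ (a * c) := by
    intro g
    obtain ⟨a, ha, k, hk, rfl⟩ : g ∈ (A : Set G) * (H : Set G) := h.eq_mul ▸ Set.mem_univ g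
    obtain ⟨c, hc, d, hd, rfl⟩ :
        k ∈ (centralizerIn H A : Set G) * ((⁅H, A⁆ : Subgroup G) : Set G) := h.eq_CD ▸ hk
    refine ⟨a, ha, c, hc, ?_⟩
    simp only [← mul_assoc]
    rw [map_mul _ (a * c) d]
    simp [(QuotientGroup.eq_one_iff d).mpr hd]
  have hA : ∀ a ∈ A, ∀ b ∈ A, Commute a b := by
    intro a ha b hb
    obtain ⟨g, hg⟩ := IsCyclic.exists_generator (α := A)
    obtain ⟨i, hi⟩ := hg ⟨a, ha⟩
    obtain ⟨j, hj⟩ := hg ⟨b, hb⟩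
    have hi' : (g : G) ^ i = a := congrArg Subtype.val hi
    have hj' : (g : G) ^ j = b := congrArg Subtype.val hj
    rw [← hi', ← hj']
    exact (Commute.refl _).zpow_zpow i j
  rw [commutator_le_iff_forall_commutatorElement_mem]
  intro g k
  rw [← QuotientGroup.eq_one_iff]
  change QuotientGroup.mk' ⁅H, A⁆ ⁅g, k⁆ = 1
  obtain ⟨a, ha, c, hc, h1⟩ := hdecomp g
  obtain ⟨b, hb, e, he, h2⟩ := hdecomp k
  rw [map_commutatorElement, h1, h2, ← map_commutatorElement]
  have hCA : ∀ x ∈ A, ∀ w ∈ centralizerIn H A, Commute x w := fun x hx w hw =>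
    Subgroup.mem_centralizer_iff.mp hw.2 x hx
  have h3 : Commute (a * c) (b * e) :=
    ((hA a ha b hb).mul_right (hCA a ha e he)).mul_left
      ((hCA b hb c hc).symm.mul_right (h.abelian_C c hc e he))
  rw [commutatorElement_eq_one_iff_commute.mpr h3, map_one]

end FrobeniusStructure

/-! ### From multiplicativity to conjugate cosets -/

section CharacterValues

open scoped commutatorElement

variable {G : Type*} [Group G]

theorem commutator_eq_bot_iff_forall_mul_comm :
    commutator G = ⊥ ↔ ∀ a b : G, a * b = b * a := by
  rw [eq_bot_iff, commutator_le_iff_forall_commutatorElement_mem]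
  simp only [Subgroup.mem_bot, commutatorElement_eq_one_iff_mul_comm]

theorem Representation.character_eq_one_of_mem_commutator {n : ℕ}
    {ρ : Representation ℂ G (Fin n → ℂ)} (hn : n = 1) {e : G} (he : e ∈ commutator G) :
    ρ.character e = 1 := by
  let f : G →* ℂ :=
    { toFun := ρ.character
      map_one' := by simp [hn]
      map_mul' := Representation.character_mul_of_degree_one hn }
  have hle : commutator G ≤ f.ker := by
    rw [commutator_le_iff_forall_commutatorElement_mem]
    intro a b
    have h1 : f a * f a⁻¹ = 1 := by rw [← map_mul, mul_inv_cancel, map_one]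
    have h2 : f b * f b⁻¹ = 1 := by rw [← map_mul, mul_inv_cancel, map_one]
    rw [MonoidHom.mem_ker, commutatorElement_def, map_mul, map_mul, map_mul]
    linear_combination h1 * f b * f b⁻¹ + h2
  exact hle he

theorem IrrChar.mul_of_forall_degree_ne_one {x y : G}
    (h : ∀ (n : ℕ) (ρ : Representation ℂ G (Fin n → ℂ)), ρ.IsIrreducible → n ≠ 1 →
      ρ.character x * ρ.character y = 0 ∧ ρ.character (x * y) = 0)
    {χ : G → ℂ} (hχ : χ ∈ IrrChar G) : χ (x * y) = χ x * χ y := by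
  obtain ⟨n, ρ, hρ, rfl⟩ := hχ
  by_cases hn : n = 1
  · exact Representation.character_mul_of_degree_one hn x y
  · rw [(h n ρ hρ hn).1, (h n ρ hρ hn).2]

theorem IrrChar.mul_of_forall_mul_comm (hcomm : ∀ a b : G, a * b = b * a) (x y : G)
    {χ : G → ℂ} (hχ : χ ∈ IrrChar G) : χ (x * y) = χ x * χ y :=
  IrrChar.mul_of_forall_degree_ne_one (fun _ ρ hρ hn => absurd
    (hρ.degree_eq_one_of_commute fun g h => by rw [← map_mul, hcomm, map_mul]) hn) hχ

variable [Finite G]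

/-- If `χ(x y^g) = χ(x) χ(y)` for all `g` and `χ` is irreducible of degree greater than one, then
`χ(x) χ(y) = 0`. -/
theorem Representation.IsIrreducible.character_mul_character_eq_zero {n : ℕ}
    {ρ : Representation ℂ G (Fin n → ℂ)} (hρ : ρ.IsIrreducible) (hn : n ≠ 1) {x y : G}
    (h : ∀ g, ρ.character (x * (g * y * g⁻¹)) = ρ.character x * ρ.character y) :
    ρ.character x * ρ.character y = 0 := by
  have : Fintype G := Fintype.ofFinite G
  have h1 := hρ.sum_character_mul_conj x y
  simp only [h, Finset.sum_const, Finset.card_univ, nsmul_eq_mul] at h1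
  have h2 : (Fintype.card G : ℂ) ≠ 0 := by exact_mod_cast Fintype.card_ne_zero
  have h3 : (n : ℂ) - 1 ≠ 0 := sub_ne_zero.mpr (by exact_mod_cast hn)
  have h4 : (Fintype.card G : ℂ) * (n - 1) * (ρ.character x * ρ.character y) = 0 := by
    linear_combination h1
  exact (mul_eq_zero.mp h4).resolve_left (mul_ne_zero h2 h3)

section Family

variable {k : ℕ} {d : Fin k → ℕ} {ρ : ∀ i, Representation ℂ G (Fin (d i) → ℂ)}

/-- Linear characters agree at z and z e, and the others vanish at z. So pairing z with z e gives
the same column sum as pairing z with itself, which is the nonzero order of the centralizer. -/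
theorem isConj_mul_of_character_eq_zero
    (hortho : ∀ z w : G, ∑ i, (ρ i).character z * (ρ i).character w⁻¹ =
      Nat.card {g : G // z * g = g * w}) {z : G}
    (hz : ∀ i, d i ≠ 1 → (ρ i).character z = 0) {e : G} (he : e ∈ commutator G) :
    IsConj z (z * e) := by
  have h1 : (Nat.card {g : G // z * g = g * (z * e)} : ℂ) = Nat.card {g : G // z * g = g * z} := by
    rw [← hortho, ← hortho]
    refine Finset.sum_congr rfl fun i _ => ?_
    by_cases hi : d i = 1
    · rw [mul_inv_rev, Representation.character_mul_of_degree_one hi e⁻¹,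
        Representation.character_eq_one_of_mem_commutator hi (inv_mem he), one_mul]
    · rw [hz i hi, zero_mul, zero_mul]
  have h2 : Nat.card {g : G // z * g = g * (z * e)} = Nat.card {g : G // z * g = g * z} := by
    exact_mod_cast h1
  have h3 : 0 < Nat.card {g : G // z * g = g * z} := by
    have : Nonempty {g : G // z * g = g * z} := ⟨⟨1, by simp⟩⟩
    exact Nat.card_pos
  rw [← h2] at h3
  obtain ⟨⟨g, hg⟩⟩ := (Nat.card_pos_iff.mp h3).1
  refine isConj_iff.mpr ⟨g⁻¹, ?_⟩
  rw [inv_inv, mul_assoc, hg, inv_mul_cancel_left]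

omit [Finite G] in
-- Orthogonality at z = w = 1 says that the squared degrees sum to |G|.
theorem sq_degree_le_card
    (hortho : ∀ z w : G, ∑ i, (ρ i).character z * (ρ i).character w⁻¹ =
      Nat.card {g : G // z * g = g * w}) (i : Fin k) : d i * d i ≤ Nat.card G := by
  have h1 := hortho 1 1
  have h2 : Nat.card {g : G // 1 * g = g * 1} = Nat.card G :=
    Nat.card_congr (Equiv.subtypeUnivEquiv fun g => by simp)
  rw [h2] at h1
  simp only [inv_one, Representation.character_one_eq] at h1
  have h3 : ∑ i, d i * d i = Nat.card G := by exact_mod_cast h1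
  rw [← h3]
  exact Finset.single_le_sum (f := fun i => d i * d i) (fun _ _ => Nat.zero_le _)
    (Finset.mem_univ i)

end Family

theorem Representation.prime_pow_dvd_degree {n : ℕ} {ρ : Representation ℂ G (Fin n → ℂ)} {q j : ℕ}
    (hq : q.Prime) (hdvd : q ^ j ∣ Nat.card G)
    (h : ∀ x : G, x ≠ 1 → IsPElement q x → ρ.character x = 0) : q ^ j ∣ n := by
  have : Fact q.Prime := ⟨hq⟩
  obtain ⟨Q, hQ⟩ := Sylow.exists_subgroup_card_pow_prime q hdvd
  rw [← hQ]
  refine Representation.card_dvd_degree_of_character_eq_zero (ρ := ρ) Q fun x hx hx1 => h x hx1 ?_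
  have h1 := orderOf_dvd_natCard (⟨x, hx⟩ : Q)
  rw [hQ, Subgroup.orderOf_mk] at h1
  obtain ⟨i, -, hi⟩ := (Nat.dvd_prime_pow hq).mp h1
  exact ⟨i, hi⟩

/-- The dichotomy: under the multiplicativity condition for the prime `p`, either every coset
`x G'` with `x ≠ 1` a `p`-element, or every coset `y G'` with `y ≠ 1` a `p'`-element of prime power
order, lies in one conjugacy class. -/
theorem forall_isConj_mul_or_forall_isConj_mul {p : ℕ} (hp : p.Prime) (hpG : p ∣ Nat.card G)
    (h : ∀ x y : G, x ≠ 1 → y ≠ 1 → IsPElement p x → IsPPrimeElement p y → HasPrimePowerOrder y →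
      ∀ χ ∈ IrrChar G, χ (x * y) = χ x * χ y) :
    (∀ x : G, x ≠ 1 → IsPElement p x → ∀ e ∈ commutator G, IsConj x (x * e)) ∨
    (∀ y : G, y ≠ 1 → IsPPrimeElement p y → HasPrimePowerOrder y →
      ∀ e ∈ commutator G, IsConj y (y * e)) := by
  obtain ⟨k, d, ρ, hρ, hortho⟩ := exists_irreducible_family_column_orthogonality G
  have hzero : ∀ i, d i ≠ 1 → ∀ x y : G, x ≠ 1 → y ≠ 1 → IsPElement p x → IsPPrimeElement p y →
      HasPrimePowerOrder y → (ρ i).character x = 0 ∨ (ρ i).character y = 0 := by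
    intro i hi x y hx hy hxp hyp hyq
    refine mul_eq_zero.mp ((hρ i).character_mul_character_eq_zero hi fun g => ?_)
    have hord : orderOf (g * y * g⁻¹) = orderOf y := by
      rw [← MulAut.conj_apply]
      exact MulEquiv.orderOf_eq (MulAut.conj g) y
    rw [h x (g * y * g⁻¹) hx (by simpa using hy) hxp (by rwa [IsPPrimeElement, hord])
      (by rwa [HasPrimePowerOrder, hord]) _ ⟨_, ρ i, hρ i, rfl⟩, Representation.char_conj]
  by_contra hcon
  rw [not_or] at hcon
  obtain ⟨h1, h2⟩ := hcon
  push Not at h1 h2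
  obtain ⟨x, hx, hxp, e, he, hxe⟩ := h1
  obtain ⟨y, hy, hyp, hyq, e', he', hye⟩ := h2
  -- A nonlinear χᵢ with χᵢ(x) ≠ 0 must vanish at every admissible y', and a nonlinear χⱼ with χⱼ(y)
  -- ≠ 0 at every admissible x'.
  obtain ⟨i, hi, hix⟩ : ∃ i, d i ≠ 1 ∧ (ρ i).character x ≠ 0 := by
    by_contra hno
    push Not at hno
    exact hxe (isConj_mul_of_character_eq_zero hortho hno he)
  obtain ⟨j, hj, hjy⟩ : ∃ j, d j ≠ 1 ∧ (ρ j).character y ≠ 0 := by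
    by_contra hno
    push Not at hno
    exact hye (isConj_mul_of_character_eq_zero hortho hno he')
  set N := Nat.card G with hN
  have hN0 : N ≠ 0 := Nat.card_pos.ne'
  have hdj : ordProj[p] N ∣ d j := Representation.prime_pow_dvd_degree (ρ := ρ j) hp
    (Nat.ordProj_dvd N p) fun x' hx' hxp' =>
      (hzero j hj x' y hx' hy hxp' hyp hyq).resolve_right hjy
  have hdi : ordCompl[p] N ∣ d i := by
    rw [Nat.dvd_iff_prime_pow_dvd_dvd]
    intro q m hq hqm
    by_cases hm : m = 0
    · simp [hm]
    have hqp : q ≠ p := by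
      rintro rfl
      exact Nat.not_dvd_ordCompl hq hN0 ((dvd_pow_self q hm).trans hqm)
    refine Representation.prime_pow_dvd_degree (ρ := ρ i) hq
      (hqm.trans (Nat.ordCompl_dvd N p)) fun y' hy' hyq' => ?_
    obtain ⟨l, hl⟩ := hyq'
    refine (hzero i hi x y' hx hy' hxp ?_ ⟨q, l, hq, hl⟩).resolve_left hix
    intro hdvd
    rw [hl] at hdvd
    exact hqp ((Nat.prime_dvd_prime_iff_eq hp hq).mp (hp.dvd_of_dvd_pow hdvd)).symm
  have hprod : ordProj[p] N * ordCompl[p] N = N := Nat.ordProj_mul_ordCompl_eq_self N p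
  have hlej := Nat.le_of_dvd (Nat.pos_of_ne_zero (hρ j).ne_zero) hdj
  have hlei := Nat.le_of_dvd (Nat.pos_of_ne_zero (hρ i).ne_zero) hdi
  have hsqj := (Nat.mul_le_mul hlej hlej).trans (sq_degree_le_card hortho j)
  have hsqi := (Nat.mul_le_mul hlei hlei).trans (sq_degree_le_card hortho i)
  replace hsqj := hsqj.trans_eq hprod.symm
  replace hsqi := hsqi.trans_eq hprod.symm
  have hle1 := Nat.le_of_mul_le_mul_left hsqj (Nat.ordProj_pos N p)
  have hle2 := Nat.le_of_mul_le_mul_right hsqi (Nat.ordCompl_pos p hN0)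
  have heq : ordProj[p] N = ordCompl[p] N := le_antisymm hle1 hle2
  apply Nat.not_dvd_ordCompl hp hN0
  rw [← heq]
  exact dvd_pow_self p (hp.factorization_pos_of_dvd hN0 hpG).ne'

/-! ### From conjugate cosets to Hall subgroups and complements -/

theorem not_dvd_card_commutator_of_isConj_mul {q : ℕ} (hq : q.Prime)
    (h : ∀ x : G, orderOf x = q → ∀ e ∈ commutator G, IsConj x (x * e)) :
    ¬ q ∣ Nat.card (commutator G) := by
  intro hdvd
  have : Fact q.Prime := ⟨hq⟩
  obtain ⟨x, hx⟩ := exists_prime_orderOf_dvd_card' q hdvd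
  have hx' : orderOf (x : G) = q := by rwa [Subgroup.orderOf_coe]
  -- With x ∈ G', the choice e = x⁻¹ makes x conjugate to 1.
  have h1 := h x hx' _ (inv_mem x.2)
  rw [mul_inv_cancel, isConj_one_left] at h1
  rw [h1, orderOf_one] at hx'
  exact hq.one_lt.ne hx'

theorem IsPGroup.of_forall_prime_not_dvd {p : ℕ} {K : Type*} [Group K] [Finite K]
    (h : ∀ q : ℕ, q.Prime → q ≠ p → ¬ q ∣ Nat.card K) : IsPGroup p K := by
  refine IsPGroup.of_card (n := (Nat.card K).primeFactorsList.length) ?_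
  exact Nat.eq_prime_pow_of_unique_prime_dvd Nat.card_pos.ne' fun {q} hq hqd => by
    by_contra hne
    exact h q hq hne hqd

omit [Finite G] in
theorem normal_of_commutator_le {H : Subgroup G} (hH : commutator G ≤ H) : H.Normal := by
  refine ⟨fun h hh g => ?_⟩
  have h1 : g * h * g⁻¹ = ⁅g, h⁆ * h := by
    rw [commutatorElement_def]
    group
  rw [h1]
  exact H.mul_mem (hH (commutatorElement_mem_commutator g h)) hh

/-- If `p` does not divide `|G'|`, then `G` has a normal Hall `p'`-subgroup. -/
theorem exists_isHallPPrimeSubgroup {p : ℕ} (hp : p.Prime)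
    (h : ¬ p ∣ Nat.card (commutator G)) :
    ∃ H : Subgroup G, commutator G ≤ H ∧ IsHallPPrimeSubgroup p H := by
  have : Fact p.Prime := ⟨hp⟩
  set N := Nat.card (Abelianization G) with hN
  have hN0 : N ≠ 0 := Nat.card_pos.ne'
  -- The kernel is the preimage of the p'-part of G/G'. An element of order p in it would have
  -- trivial image, hence lie in G'.
  let f : G →* Abelianization G := (powMonoidHom (ordCompl[p] N)).comp Abelianization.of
  have hf : ∀ g, f g = Abelianization.of g ^ (ordCompl[p] N) := fun g => rfl
  refine ⟨f.ker, Abelianization.commutator_subset_ker f, ?_, ?_⟩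
  · intro hdvd
    obtain ⟨x, hx⟩ := exists_prime_orderOf_dvd_card' p hdvd
    have h1 : Abelianization.of (x : G) = 1 := by
      have h2 : Abelianization.of (x : G) ^ (ordCompl[p] N) = 1 := x.2
      have h3 : Abelianization.of (x : G) ^ p = 1 := by
        rw [← map_pow, ← Subgroup.coe_pow, ← hx, pow_orderOf_eq_one, Subgroup.coe_one, map_one]
      rw [← orderOf_eq_one_iff]
      refine Nat.Coprime.eq_one_of_dvd ?_ (orderOf_dvd_of_pow_eq_one h2)
      exact (Nat.coprime_ordCompl hp hN0).coprime_dvd_left (orderOf_dvd_of_pow_eq_one h3)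
    have hxc : (x : G) ∈ commutator G := (QuotientGroup.eq_one_iff _).mp h1
    apply h
    have := orderOf_dvd_natCard (⟨x, hxc⟩ : commutator G)
    rwa [Subgroup.orderOf_mk, Subgroup.orderOf_coe, hx] at this
  · rw [Subgroup.index_ker]
    refine IsPGroup.iff_card.mp fun y => ⟨N.factorization p, ?_⟩
    obtain ⟨y, g, rfl⟩ := y
    apply Subtype.ext
    change f g ^ _ = 1
    rw [hf, ← pow_mul, mul_comm, Nat.ordProj_mul_ordCompl_eq_self]
    exact pow_card_eq_one'

omit [Finite G] in
theorem Subgroup.orderOf_dvd_natCard_of_mem {A : Subgroup G} {a : G} (ha : a ∈ A) :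
    orderOf a ∣ Nat.card A := by
  simpa using _root_.orderOf_dvd_natCard (⟨a, ha⟩ : A)

theorem exists_hall_hasFrobeniusStructure {p : ℕ} (hp : p.Prime) (hpG : p ∣ Nat.card G)
    (hnonab : commutator G ≠ ⊥)
    (h : ∀ x : G, x ≠ 1 → IsPElement p x → ∀ e ∈ commutator G, IsConj x (x * e)) :
    ∃ A H : Subgroup G, IsHallPPrimeSubgroup p H ∧ HasFrobeniusStructure A H := by
  have hG' : ¬ p ∣ Nat.card (commutator G) :=
    not_dvd_card_commutator_of_isConj_mul hp fun x hx => h x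
      (fun h1 => hp.one_lt.ne (by rw [← hx, h1, orderOf_one])) ⟨1, by rw [hx, pow_one]⟩
  obtain ⟨H, hle, hH⟩ := exists_isHallPPrimeSubgroup hp hG'
  have := normal_of_commutator_le hle
  obtain ⟨k, hk⟩ := hH.2
  have hcop : (Nat.card H).Coprime H.index := by
    rw [hk]
    exact ((hp.coprime_iff_not_dvd.mpr hH.1).pow_left k).symm
  obtain ⟨A, hA⟩ := Subgroup.exists_left_complement'_of_coprime hcop
  have hcard : Nat.card A = p ^ k := by rw [← hk, hA.index_eq_card]
  refine ⟨A, H, hH, hasFrobeniusStructure_of_isComplement hnonab hle ?_ hA ?_⟩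
  · rintro rfl
    apply hH.1
    have h1 := H.card_mul_index
    rw [hk, ← hcard, Subgroup.card_bot, mul_one] at h1
    rwa [h1]
  · intro a ha hprime e he hae
    have h1 : orderOf a = p := (Nat.prime_dvd_prime_iff_eq hprime hp).mp
      (hprime.dvd_of_dvd_pow (hcard ▸ Subgroup.orderOf_dvd_natCard_of_mem ha))
    refine eq_one_of_commute_of_coset_conj (commutator G) (h a ?_ ⟨1, by rw [h1, pow_one]⟩) ?_
      he hae
    · rintro rfl
      rw [orderOf_one] at h1
      exact hp.one_lt.ne h1
    · rw [h1]
      exact hp.coprime_iff_not_dvd.mpr hG'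

/-- No prime other than p divides |G'|, so G' lies in a Sylow p-subgroup, which is therefore normal
and has a complement. -/
theorem exists_sylow_hasFrobeniusStructure {p : ℕ} (hp : p.Prime) (hG : ¬ IsPGroup p G)
    (hnonab : commutator G ≠ ⊥)
    (h : ∀ y : G, y ≠ 1 → IsPPrimeElement p y → HasPrimePowerOrder y →
      ∀ e ∈ commutator G, IsConj y (y * e)) :
    ∃ A H : Subgroup G, IsPPrimeGroup p A ∧ IsSylowSubgroup p H ∧ HasFrobeniusStructure A H := by
  have : Fact p.Prime := ⟨hp⟩
  have hprime : ∀ y : G, (orderOf y).Prime → orderOf y ≠ p →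
      ∀ e ∈ commutator G, IsConj y (y * e) := by
    intro y hy hyp
    refine h y ?_ (fun hdvd => hyp ((Nat.prime_dvd_prime_iff_eq hp hy).mp hdvd).symm)
      ⟨_, 1, hy, (pow_one _).symm⟩
    rintro rfl
    exact hy.one_lt.ne orderOf_one.symm
  have hG' : ∀ q : ℕ, q.Prime → q ≠ p → ¬ q ∣ Nat.card (commutator G) := fun q hq hqp =>
    not_dvd_card_commutator_of_isConj_mul hq fun x hx =>
      hprime x (hx.symm ▸ hq) (hx.symm ▸ hqp)
  obtain ⟨P, hP⟩ := (IsPGroup.of_forall_prime_not_dvd hG').exists_le_sylow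
  have hPn := normal_of_commutator_le hP
  have hcop : (Nat.card (P : Subgroup G)).Coprime (P : Subgroup G).index := P.card_coprime_index
  obtain ⟨A, hA⟩ := Subgroup.exists_left_complement'_of_coprime hcop
  have hcard : Nat.card A = (P : Subgroup G).index := hA.index_eq_card.symm
  have hpA : ¬ p ∣ Nat.card A := hcard ▸ P.not_dvd_index
  refine ⟨A, P, hpA, ⟨P.2, P.not_dvd_index⟩,
    hasFrobeniusStructure_of_isComplement hnonab hP ?_ hA ?_⟩
  · rintro rfl
    rw [Subgroup.card_bot, eq_comm, Subgroup.index_eq_one] at hcard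
    apply hG
    have h1 := P.2
    rw [hcard] at h1
    exact h1.of_equiv Subgroup.topEquiv
  · intro a ha haprime e he hae
    have hne : orderOf a ≠ p := fun h1 => hpA (h1 ▸ Subgroup.orderOf_dvd_natCard_of_mem ha)
    exact eq_one_of_commute_of_coset_conj (commutator G) (hprime a haprime hne)
      (haprime.coprime_iff_not_dvd.mpr (hG' _ haprime hne)) he hae

/-! ### The converse: multiplicativity from the Frobenius structure -/

theorem IsSylowSubgroup.coprime_card_index {p : ℕ} (hp : p.Prime) {H : Subgroup G}
    (hH : IsSylowSubgroup p H) : (Nat.card H).Coprime H.index := by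
  have : Fact p.Prime := ⟨hp⟩
  obtain ⟨k, hk⟩ := IsPGroup.iff_card.mp hH.1
  rw [hk]
  exact (hp.coprime_iff_not_dvd.mpr hH.2).pow_left k

omit [Finite G] in
theorem IsHallPPrimeSubgroup.coprime_card_index {p : ℕ} (hp : p.Prime) {H : Subgroup G}
    (hH : IsHallPPrimeSubgroup p H) : (Nat.card H).Coprime H.index := by
  obtain ⟨k, hk⟩ := hH.2
  rw [hk]
  exact ((hp.coprime_iff_not_dvd.mpr hH.1).pow_left k).symm

theorem HasFrobeniusStructure.character_eq_zero {A H : Subgroup G}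
    (h : HasFrobeniusStructure A H) (hcop : (Nat.card H).Coprime H.index) {n : ℕ}
    {ρ : Representation ℂ G (Fin n → ℂ)} (hρ : ρ.IsIrreducible) (hn : n ≠ 1) {z : G}
    (hz : z ∉ H) : ρ.character z = 0 := by
  have := h.normal_D
  exact hρ.character_eq_zero_of_coset_conj hn ⁅H, A⁆ h.commutator_le z
    fun e he => h.isConj_mul hcop hz he

omit [Finite G] in
theorem Subgroup.mem_of_mul_mem_of_coprime_orderOf {H : Subgroup G} [H.Normal] {x y : G}
    (hxy : (orderOf x).Coprime (orderOf y)) (hmem : x * y ∈ H) : x ∈ H := by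
  have h1 : (QuotientGroup.mk' H x) * (QuotientGroup.mk' H y) = 1 := by
    rw [← map_mul]
    exact (QuotientGroup.eq_one_iff _).mpr hmem
  have h2 : orderOf (QuotientGroup.mk' H x) ∣ orderOf y := by
    rw [eq_inv_of_mul_eq_one_left h1, orderOf_inv]
    exact orderOf_map_dvd _ y
  have h3 := Nat.Coprime.eq_one_of_dvd (hxy.coprime_dvd_left (orderOf_map_dvd _ x)) h2
  exact (QuotientGroup.eq_one_iff _).mp (orderOf_eq_one_iff.mp h3)

/-- Nonlinear characters vanish off H. One of x, y is outside H, and so is x y, because coprime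
orders would put both factors in H. -/
theorem HasFrobeniusStructure.irrChar_mul {A H : Subgroup G} (h : HasFrobeniusStructure A H)
    (hcop : (Nat.card H).Coprime H.index) {x y : G} (hxy : (orderOf x).Coprime (orderOf y))
    (hmem : x ∈ H → y ∉ H) {χ : G → ℂ} (hχ : χ ∈ IrrChar G) : χ (x * y) = χ x * χ y := by
  have := h.normal
  refine IrrChar.mul_of_forall_degree_ne_one (fun n ρ hρ hn => ⟨?_, ?_⟩) hχ
  · by_cases hx : x ∈ H
    · rw [h.character_eq_zero hcop hρ hn (hmem hx), mul_zero]
    · rw [h.character_eq_zero hcop hρ hn hx, zero_mul]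
  · refine h.character_eq_zero hcop hρ hn fun hxyH => ?_
    have hx := Subgroup.mem_of_mul_mem_of_coprime_orderOf hxy hxyH
    exact hmem hx ((H.mul_mem_cancel_left hx).mp hxyH)

omit [Finite G] in
theorem IsPElement.dvd_orderOf {p : ℕ} {x : G} (hx : IsPElement p x) (hx1 : x ≠ 1) :
    p ∣ orderOf x := by
  obtain ⟨k, hk⟩ := hx
  rw [hk]
  refine dvd_pow_self p ?_
  rintro rfl
  exact hx1 (orderOf_eq_one_iff.mp hk)

omit [Finite G] in
theorem IsPElement.coprime_orderOf {p : ℕ} (hp : p.Prime) {x y : G} (hx : IsPElement p x)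
    (hy : IsPPrimeElement p y) : (orderOf x).Coprime (orderOf y) := by
  obtain ⟨k, hk⟩ := hx
  rw [hk]
  exact (hp.coprime_iff_not_dvd.mpr hy).pow_left k

omit [Finite G] in
theorem IsPGroup.isPElement_of_mem {p : ℕ} (hp : p.Prime) {H : Subgroup G} (hH : IsPGroup p H)
    {x : G} (hx : x ∈ H) : IsPElement p x := by
  have : Fact p.Prime := ⟨hp⟩
  obtain ⟨k, hk⟩ := IsPGroup.iff_orderOf.mp hH ⟨x, hx⟩
  exact ⟨k, by rwa [Subgroup.orderOf_mk] at hk⟩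

omit [Finite G] in
theorem IsPGroup.not_mem_of_coprime {p : ℕ} (hp : p.Prime) {H : Subgroup G} (hH : IsPGroup p H)
    {x y : G} (hx1 : x ≠ 1) (hy1 : y ≠ 1) (hxy : (orderOf x).Coprime (orderOf y)) (hx : x ∈ H) :
    y ∉ H := fun hy =>
  Nat.not_coprime_of_dvd_of_dvd hp.one_lt ((hH.isPElement_of_mem hp hx).dvd_orderOf hx1)
    ((hH.isPElement_of_mem hp hy).dvd_orderOf hy1) hxy

end CharacterValues

/-! ### The two classifications -/

theorem theorem3p2 (G : Type*) [Group G] [Finite G] :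
    (∀ p : ℕ, p.Prime →
      ((∀ x y : G, x ≠ 1 → y ≠ 1 → IsPElement p x → IsPPrimeElement p y → HasPrimePowerOrder y →
          ∀ χ ∈ IrrChar G, χ (x * y) = χ x * χ y) ↔
        (IsPGroup p G ∨ IsPPrimeGroup p G ∨ (∀ a b : G, a * b = b * a) ∨
          ∃ A H : Subgroup G, (IsSylowSubgroup p H ∨ IsHallPPrimeSubgroup p H) ∧
            HasFrobeniusStructure A H))) ∧
    ((∀ x y : G, x ≠ 1 → y ≠ 1 → HasPrimePowerOrder x → HasPrimePowerOrder y →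
        Nat.Coprime (orderOf x) (orderOf y) →
          ∀ χ ∈ IrrChar G, χ (x * y) = χ x * χ y) ↔
      ((∃ q : ℕ, q.Prime ∧ IsPGroup q G) ∨ (∀ a b : G, a * b = b * a) ∨
        ∃ q : ℕ, q.Prime ∧ ∃ A P : Subgroup G, IsPPrimeGroup q A ∧ IsSylowSubgroup q P ∧
          HasFrobeniusStructure A P)) := by
  refine ⟨fun p hp => ⟨fun h => ?_, ?_⟩, ⟨fun h => ?_, ?_⟩⟩
  · by_cases hpG : p ∣ Nat.card G
    swap
    · exact Or.inr (Or.inl hpG)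
    by_cases hpg : IsPGroup p G
    · exact Or.inl hpg
    by_cases hab : ∀ a b : G, a * b = b * a
    · exact Or.inr (Or.inr (Or.inl hab))
    have hnonab : commutator G ≠ ⊥ := fun h0 => hab (commutator_eq_bot_iff_forall_mul_comm.mp h0)
    refine Or.inr (Or.inr (Or.inr ?_))
    rcases forall_isConj_mul_or_forall_isConj_mul hp hpG h with h1 | h1
    · obtain ⟨A, H, hH, hA⟩ := exists_hall_hasFrobeniusStructure hp hpG hnonab h1
      exact ⟨A, H, Or.inr hH, hA⟩
    · obtain ⟨A, H, -, hH, hA⟩ := exists_sylow_hasFrobeniusStructure hp hpg hnonab h1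
      exact ⟨A, H, Or.inl hH, hA⟩
  · rintro h x y hx hy hxp hyp - χ hχ
    have hcop := hxp.coprime_orderOf hp hyp
    rcases h with h | h | h | ⟨A, H, hH | hH, hA⟩
    · have h1 := (h.to_subgroup ⊤).isPElement_of_mem hp (Subgroup.mem_top y)
      exact absurd (h1.dvd_orderOf hy) hyp
    · exact absurd ((hxp.dvd_orderOf hx).trans (orderOf_dvd_natCard x)) h
    · exact IrrChar.mul_of_forall_mul_comm h x y hχ
    · exact hA.irrChar_mul (hH.coprime_card_index hp) hcop
        (hH.1.not_mem_of_coprime hp hx hy hcop) hχ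
    · exact hA.irrChar_mul (hH.coprime_card_index hp) hcop
        (fun hxH => absurd ((hxp.dvd_orderOf hx).trans
          (Subgroup.orderOf_dvd_natCard_of_mem hxH)) hH.1) hχ
  · by_cases hpg : ∃ q : ℕ, q.Prime ∧ IsPGroup q G
    · exact Or.inl hpg
    by_cases hab : ∀ a b : G, a * b = b * a
    · exact Or.inr (Or.inl hab)
    have hnonab : commutator G ≠ ⊥ := fun h0 => hab (commutator_eq_bot_iff_forall_mul_comm.mp h0)
    have hnt : Nat.card (commutator G) ≠ 1 := fun h1 => hnonab (Subgroup.card_eq_one.mp h1)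
    -- Taking p to divide |G'|, not just |G|, rules out the alternative about p-elements and leaves
    -- the normal Sylow case.
    obtain ⟨p, hp, hpG'⟩ := Nat.exists_prime_and_dvd hnt
    have hpG : p ∣ Nat.card G := hpG'.trans (Subgroup.card_subgroup_dvd_card _)
    refine Or.inr (Or.inr ⟨p, hp, ?_⟩)
    have h' : ∀ x y : G, x ≠ 1 → y ≠ 1 → IsPElement p x → IsPPrimeElement p y →
        HasPrimePowerOrder y → ∀ χ ∈ IrrChar G, χ (x * y) = χ x * χ y := by
      intro x y hx hy hxp hyp hyq
      obtain ⟨k, hk⟩ := hxp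
      exact h x y hx hy ⟨p, k, hp, hk⟩ hyq (IsPElement.coprime_orderOf hp ⟨k, hk⟩ hyp)
    rcases forall_isConj_mul_or_forall_isConj_mul hp hpG h' with h1 | h1
    · refine absurd hpG' (not_dvd_card_commutator_of_isConj_mul hp fun x hx => h1 x ?_
        ⟨1, by rw [hx, pow_one]⟩)
      rintro rfl
      rw [orderOf_one] at hx
      exact hp.one_lt.ne hx
    · exact exists_sylow_hasFrobeniusStructure hp (fun h2 => hpg ⟨p, hp, h2⟩) hnonab h1
  · rintro h x y hx hy - - hcop χ hχ
    rcases h with ⟨q, hq, h⟩ | h | ⟨q, hq, A, P, -, hP, hA⟩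
    · exact absurd (Subgroup.mem_top y)
        ((h.to_subgroup ⊤).not_mem_of_coprime hq hx hy hcop (Subgroup.mem_top x))
    · exact IrrChar.mul_of_forall_mul_comm h x y hχ
    · exact hA.irrChar_mul (hP.coprime_card_index hq) hcop
        (hP.1.not_mem_of_coprime hq hx hy hcop) hχ
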